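/- Let $n\ge 2$ and let $a:\mathbb{R}\to(0,\infty)$ be smooth with (i) $a(t)\to 0$, (ii) $\int_t^1\frac{ds}{a(s)}\to\infty$ and (iii) $a(t)\int_t^1\frac{ds}{a(s)}\to\infty$ as $t\to-\infty$. Let $M=\mathbb{R}\times\mathbb{R}^n$ carry the spatially flat FLRW metric $g=-dt^2+a(t)^2\delta$, where $\delta$ is the Euclidean metric, and let $M_1=(-\infty,1)\times\mathbb{R}^n$ with the restricted metric. For $(t,x)\in M_1$ put $\hat t=-\ln\int_t^1\frac{ds}{a(s)}$, $r=|x|$ and, if $x\neq0$, $\omega=x/|x|\in\mathbb{S}^{n-1}$, and let $T\in(-\frac{\pi}{2},\frac{\pi}{2})$, $R\in[0,\pi)$ with $T>R-\frac{\pi}{2}$ be determined by $$e^{\hat t}=\frac{\sin T+\cos R}{\cos T},\qquad r=\frac{\sin R}{\sin T+\cos R}.$$ Let $\gamma_1,\gamma_2$ be future directed, past inextendible timelike curves in $M_1$, both parameterized by $t$, with $T_i=\lim_{t\to-\infty}T\circ\gamma_i(t)\in(-\frac{\pi}{2},\frac{\pi}{2})$, and let $\omega_i=\lim_{t\to-\infty}\omega\circ\gamma_i(t)\in\mathbb{S}^{n-1}$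 for $i=1,2$. Let $q\in M_1$ be such that neither curve meets the causal past $J^-(q,M_1)$ of $q$ in $M_1$. If $\omega_1\neq\omega_2$, then $$d_{\Sigma_t\setminus J^-(q,M_1)}\big(\gamma_1(t),\gamma_2(t)\big)\to\infty\quad\text{as } t\to-\infty,$$ where $\Sigma_t=\{t\}\times\mathbb{R}^n$ and $d_{\Sigma_t\setminus J^-(q,M_1)}$ is the distance of the Riemannian metric that $g$ induces on $\Sigma_t\setminus J^-(q,M_1)$, i.e. the infimum of the lengths of the piecewise smooth curves within this set. -/

import Mathlib

open Set Filter Topology MeasureTheory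
open scoped ContDiff ENNReal

noncomputable section

namespace FLRW

/-- The manifold `M = ℝ × ℝⁿ`; the first component is the comoving time `t`. -/
abbrev Spacetime (n : ℕ) : Type := ℝ × EuclideanSpace ℝ (Fin n)

/-- The metric `g = -dt² + a(t)² δ` at the point `p`, applied to tangent vectors `v`, `w`. -/
def metric {n : ℕ} (a : ℝ → ℝ) (p v w : Spacetime n) : ℝ :=
  -(v.1 * w.1) + a p.1 ^ 2 * inner ℝ v.2 w.2

/-- `v` is a future directed timelike tangent vector at `p`. -/
def IsFutureTimelike {n : ℕ} (a : ℝ → ℝ) (p v : Spacetime n) : Prop :=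
  metric a p v v < 0 ∧ 0 < v.1

/-- `v` is a future directed causal (hence nonzero) tangent vector at `p`. -/
def IsFutureCausal {n : ℕ} (a : ℝ → ℝ) (p v : Spacetime n) : Prop :=
  metric a p v v ≤ 0 ∧ 0 < v.1

/-- The open submanifold `M₁ = (-∞, 1) × ℝⁿ`. -/
def M₁ (n : ℕ) : Set (Spacetime n) := {p | p.1 < 1}

/-- `γ`, restricted to the interval `I`, is a continuous and piecewise smooth curve (its break
points `P` being finitely many in every compact subinterval of `I`) all of whose tangent vectors,
the one-sided ones at the ends of each smooth piece included, satisfy the condition `Φ`. -/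
def IsPiecewiseSmoothCurve {n : ℕ} (I : Set ℝ) (Φ : Spacetime n → Spacetime n → Prop)
    (γ : ℝ → Spacetime n) : Prop :=
  ContinuousOn γ I ∧ ∃ P : Set ℝ, (∀ c ∈ I, ∀ d ∈ I, (P ∩ Icc c d).Finite) ∧
    ∀ c ∈ I, ∀ d ∈ I, c < d → Disjoint P (Ioo c d) →
      ContDiffOn ℝ ∞ γ (Icc c d) ∧
        ∀ s ∈ Icc c d, Φ (γ s) (derivWithin γ (Icc c d) s)

/-- The causal past `J⁻(q, U)` of `q` within `U`: `q` itself and the starting points of the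
future directed causal curves in `U` that end at `q`. -/
def causalPast {n : ℕ} (a : ℝ → ℝ) (U : Set (Spacetime n)) (q : Spacetime n) :
    Set (Spacetime n) :=
  {p | p ∈ U ∧ (p = q ∨ ∃ σ : ℝ → Spacetime n,
    IsPiecewiseSmoothCurve (Icc 0 1) (IsFutureCausal a) σ ∧
      σ 0 = p ∧ σ 1 = q ∧ ∀ s ∈ Icc (0 : ℝ) 1, σ s ∈ U)}

/-- The curve `γ : I → U` has no past endpoint in `U`. The filter `atBot` on `I` is the one of
the parameter decreasing to the lower end of `I`. -/
def IsPastInextendible {n : ℕ} (U : Set (Spacetime n)) (I : Set ℝ) (γ : ℝ → Spacetime n) :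
    Prop :=
  ¬ ∃ p ∈ U, Tendsto (fun s : I => γ s) atBot (𝓝 p)

/-- `γ : I → U` is a future directed past inextendible timelike curve in `U`, defined on a
nonempty interval `I` and parameterized by the time coordinate `t`. -/
structure IsPastInextendibleTimelikeCurve {n : ℕ} (a : ℝ → ℝ) (U : Set (Spacetime n))
    (I : Set ℝ) (γ : ℝ → Spacetime n) : Prop where
  nonempty : I.Nonempty
  ordConnected : I.OrdConnected
  mem : ∀ t ∈ I, γ t ∈ U
  param : ∀ t ∈ I, (γ t).1 = t
  timelike : IsPiecewiseSmoothCurve I (IsFutureTimelike a) γ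
  pastInextendible : IsPastInextendible U I γ

/-- The time `t̂(t) = -ln ∫ₜ¹ ds / a(s)`. -/
def tHat (a : ℝ → ℝ) (t : ℝ) : ℝ := -Real.log (∫ s in t..1, 1 / a s)

/-- The coordinate `T` as a function of `(t̂, r)`; see `TR_iff`. -/
def TOf (τ r : ℝ) : ℝ :=
  Real.pi / 2 - Real.arctan (Real.exp (-τ) + r) - Real.arctan (Real.exp (-τ) - r)

/-- The coordinate `R` as a function of `(t̂, r)`; see `TR_iff`. -/
def ROf (τ r : ℝ) : ℝ :=
  Real.arctan (Real.exp (-τ) + r) - Real.arctan (Real.exp (-τ) - r)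

/-- `(TOf τ r, ROf τ r)` is the unique solution `(T, R)` of the equations
`exp τ = (sin T + cos R) / cos T` and `r = sin R / (sin T + cos R)` in the region
`-π/2 < T < π/2`, `0 ≤ R < π`, `T > R - π/2` (the centre `r = 0` corresponds to `R = 0`). -/
theorem TR_iff {τ r : ℝ} (hr : 0 ≤ r) (T R : ℝ) :
    (T = TOf τ r ∧ R = ROf τ r) ↔
      (-(Real.pi / 2) < T ∧ T < Real.pi / 2 ∧ 0 ≤ R ∧ R < Real.pi ∧ R - Real.pi / 2 < T ∧
        Real.exp τ = (Real.sin T + Real.cos R) / Real.cos T ∧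
        r = Real.sin R / (Real.sin T + Real.cos R)) := by
  have hpos := Real.exp_pos (-τ)
  have hpi := Real.pi_pos
  have key : ∀ A B : ℝ, Real.cos A ≠ 0 → Real.cos B ≠ 0 →
      Real.sin (Real.pi / 2 - A - B) + Real.cos (A - B) = 2 * (Real.cos A * Real.cos B) ∧
      Real.cos (Real.pi / 2 - A - B)
        = (Real.tan A + Real.tan B) * (Real.cos A * Real.cos B) ∧
      Real.sin (A - B) = (Real.tan A - Real.tan B) * (Real.cos A * Real.cos B) := by
    intro A B hA hB
    have e : Real.pi / 2 - A - B = Real.pi / 2 - (A + B) := by ring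
    rw [e, Real.sin_pi_div_two_sub, Real.cos_pi_div_two_sub, Real.cos_add, Real.cos_sub,
      Real.sin_add, Real.sin_sub, Real.tan_eq_sin_div_cos, Real.tan_eq_sin_div_cos]
    refine ⟨by ring, ?_, ?_⟩ <;> field_simp
  constructor
  · rintro ⟨rfl, rfl⟩
    unfold TOf ROf
    have h1 := Real.arctan_lt_pi_div_two (Real.exp (-τ) + r)
    have h2 := Real.arctan_lt_pi_div_two (Real.exp (-τ) - r)
    have h3 := Real.neg_pi_div_two_lt_arctan (Real.exp (-τ) + r)
    have h4 := Real.neg_pi_div_two_lt_arctan (Real.exp (-τ) - r)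
    have h5 : Real.arctan (Real.exp (-τ) - r) ≤ Real.arctan (Real.exp (-τ) + r) :=
      Real.arctan_strictMono.monotone (by linarith)
    have h6 : Real.arctan (-(Real.exp (-τ) - r)) < Real.arctan (Real.exp (-τ) + r) :=
      Real.arctan_strictMono (by linarith)
    rw [Real.arctan_neg] at h6
    have c1 := Real.cos_arctan_pos (Real.exp (-τ) + r)
    have c2 := Real.cos_arctan_pos (Real.exp (-τ) - r)
    obtain ⟨k1, k2, k3⟩ := key _ _ c1.ne' c2.ne'
    refine ⟨by linarith, by linarith, by linarith, by linarith, by linarith, ?_, ?_⟩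
    · rw [k1, k2, Real.tan_arctan, Real.tan_arctan]
      have : Real.exp (-τ) + r + (Real.exp (-τ) - r) = 2 * Real.exp (-τ) := by ring
      rw [this, mul_div_mul_right _ _ (mul_pos c1 c2).ne', Real.exp_neg]
      have := Real.exp_pos τ
      field_simp
    · rw [k1, k3, Real.tan_arctan, Real.tan_arctan,
        mul_div_mul_right _ _ (mul_pos c1 c2).ne']
      ring
  · rintro ⟨h1, h2, h3, h4, h5, e1, e2⟩
    obtain ⟨A, hA⟩ : ∃ A, A = (Real.pi / 2 - T + R) / 2 := ⟨_, rfl⟩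
    obtain ⟨B, hB⟩ : ∃ B, B = (Real.pi / 2 - T - R) / 2 := ⟨_, rfl⟩
    have hT : T = Real.pi / 2 - A - B := by rw [hA, hB]; ring
    have hR : R = A - B := by rw [hA, hB]; ring
    have a1 : -(Real.pi / 2) < A := by linarith
    have a2 : A < Real.pi / 2 := by linarith
    have b1 : -(Real.pi / 2) < B := by linarith
    have b2 : B < Real.pi / 2 := by linarith
    have c1 := Real.cos_pos_of_mem_Ioo ⟨a1, a2⟩
    have c2 := Real.cos_pos_of_mem_Ioo ⟨b1, b2⟩
    have c3 := (mul_pos c1 c2).ne'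
    obtain ⟨k1, k2, k3⟩ := key A B c1.ne' c2.ne'
    rw [hT, hR, k1, k2, mul_div_mul_right _ _ c3] at e1
    rw [hT, hR, k1, k3, mul_div_mul_right _ _ c3] at e2
    have e3 : Real.exp (-τ) = (Real.tan A + Real.tan B) / 2 := by
      rw [Real.exp_neg, e1, inv_div]
    have f1 : Real.exp (-τ) + r = Real.tan A := by rw [e3, e2]; ring
    have f2 : Real.exp (-τ) - r = Real.tan B := by rw [e3, e2]; ring
    unfold TOf ROf
    rw [f1, f2, Real.arctan_tan a1 a2, Real.arctan_tan b1 b2]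
    exact ⟨hT, hR⟩

/-- The coordinate function `T` on `M₁`. -/
def coordT {n : ℕ} (a : ℝ → ℝ) (p : Spacetime n) : ℝ := TOf (tHat a p.1) ‖p.2‖

/-- The angular coordinate `ω = x / |x|`, a unit vector (it is `0` on the centre line `x = 0`,
where the spherical coordinates are undefined). -/
def coordω {n : ℕ} (p : Spacetime n) : EuclideanSpace ℝ (Fin n) := ‖p.2‖⁻¹ • p.2

/-- The hypersurface `Σ_t` of `M₁`. -/
def slice (n : ℕ) (t : ℝ) : Set (Spacetime n) := {p | p ∈ M₁ n ∧ p.1 = t}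

/-- The length `∫₀¹ √(g(σ', σ'))` of a spacelike curve `σ` on `[0, 1]`. -/
def curveLength {n : ℕ} (a : ℝ → ℝ) (σ : ℝ → Spacetime n) : ℝ≥0∞ :=
  ∫⁻ s in Icc (0 : ℝ) 1, ENNReal.ofReal (√(metric a (σ s) (deriv σ s) (deriv σ s)))

/-- The distance of `x` and `y` with respect to the Riemannian metric induced by `g` on an open
subset `S` of a slice: the infimum of the lengths of the piecewise smooth curves in `S` that join
`x` to `y` (which is `∞` if there are none). -/
def inducedDist {n : ℕ} (a : ℝ → ℝ) (S : Set (Spacetime n)) (x y : Spacetime n) : ℝ≥0∞ :=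
  ⨅ (σ : ℝ → Spacetime n) (_ : IsPiecewiseSmoothCurve (Icc 0 1) (fun _ _ => True) σ ∧
    σ 0 = x ∧ σ 1 = y ∧ ∀ s ∈ Icc (0 : ℝ) 1, σ s ∈ S), curveLength a σ

end FLRW

end

/-! Put `F t = ∫ s in t..1, 1 / a s`, so that `exp (-t̂) = F t → ∞`. A limit of `T` inside `(-π/2,
π/2)` forces `F - r` to converge, so `r / F → 1` and the position `xᵢ` of `γᵢ` satisfies `xᵢ / F →
ωᵢ` (`tendsto_inv_smul_of_tendsto_coord`). Hence `a * ‖x₁ - x₂‖ = (a * F) * ‖x₁ / F - x₂ / F‖` tends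
to infinity by (iii), as `ω₁ ≠ ω₂`.

Curves confined to a subset of `Σ_t` are still no shorter than `a t` times the Euclidean chord
(`ofReal_mul_norm_sub_le_inducedDist`), so this bound suffices whatever the shape of the causal
past. -/

/-- The chord of a continuous path is no longer than the integral of its speed. -/
theorem enorm_sub_le_lintegral_enorm_deriv {E : Type*} [NormedAddCommGroup E] [NormedSpace ℝ E]
    [CompleteSpace E] {f : ℝ → E} {a b : ℝ} (hab : a ≤ b) (hf : ContinuousOn f (Icc a b))
    {s : Set ℝ} (hs : s.Countable) (hd : ∀ x ∈ Ioo a b \ s, DifferentiableAt ℝ f x) :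
    ‖f b - f a‖ₑ ≤ ∫⁻ x in Icc a b, ‖deriv f x‖ₑ := by
  -- Finiteness of the right side is exactly the integrability of `deriv f` that the fundamental
  -- theorem of calculus needs.
  by_cases htop : ∫⁻ x in Icc a b, ‖deriv f x‖ₑ = ⊤
  · rw [htop]
    exact le_top
  have hmeas : AEStronglyMeasurable (deriv f) (volume.restrict (Icc a b)) :=
    aestronglyMeasurable_deriv f _
  have hint : IntegrableOn (deriv f) (Icc a b) := ⟨hmeas, lt_top_iff_ne_top.2 htop⟩
  have hint' : IntervalIntegrable (deriv f) volume a b :=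
    (intervalIntegrable_iff_integrableOn_Icc_of_le hab).2 hint
  rw [← integral_eq_of_hasDerivAt_off_countable_of_le f (deriv f) hab hs hf
    (fun x hx => (hd x hx).hasDerivAt) hint', intervalIntegral.integral_of_le hab,
    ← integral_Icc_eq_integral_Ioc]
  exact enorm_integral_le_lintegral_enorm _

namespace FLRW

/-- A piecewise smooth curve is differentiable off its break points. -/
theorem IsPiecewiseSmoothCurve.exists_countable_differentiableAt {n : ℕ}
    {Φ : Spacetime n → Spacetime n → Prop} {σ : ℝ → Spacetime n}
    (hσ : IsPiecewiseSmoothCurve (Icc 0 1) Φ σ) :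
    ∃ s : Set ℝ, s.Countable ∧ ∀ x ∈ Ioo (0 : ℝ) 1 \ s, DifferentiableAt ℝ σ x := by
  obtain ⟨-, P, hP, hsm⟩ := hσ
  have hfin : (P ∩ Icc 0 1).Finite :=
    hP 0 (left_mem_Icc.2 zero_le_one) 1 (right_mem_Icc.2 zero_le_one)
  refine ⟨P ∩ Icc 0 1, hfin.countable, fun x hx => ?_⟩
  have hopen : Ioo (0 : ℝ) 1 \ (P ∩ Icc 0 1) ∈ 𝓝 x :=
    (isOpen_Ioo.sdiff hfin.isClosed).mem_nhds hx
  obtain ⟨c, d, hxcd, hcdx, hsub⟩ := exists_Icc_mem_subset_of_mem_nhds hopen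
  have hcd : c ≤ d := hxcd.1.trans hxcd.2
  have hlt : c < d := by
    have h := Icc_mem_nhds_iff.1 hcdx
    exact h.1.trans h.2
  have hI : ∀ y ∈ Icc c d, y ∈ Icc (0 : ℝ) 1 := fun y hy => Ioo_subset_Icc_self (hsub hy).1
  have hdisj : Disjoint P (Ioo c d) := by
    rw [Set.disjoint_left]
    intro y hyP hy
    have hy' := Ioo_subset_Icc_self hy
    exact (hsub hy').2 ⟨hyP, hI y hy'⟩
  have h := (hsm c (hI c (left_mem_Icc.2 hcd)) d (hI d (right_mem_Icc.2 hcd)) hlt hdisj).1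
  exact (h.contDiffAt hcdx).differentiableAt (by simp)

/-- The length of a curve within a slice is at least the Euclidean distance of its endpoints,
rescaled by the scale factor. -/
theorem ofReal_mul_norm_sub_le_curveLength {n : ℕ} {a : ℝ → ℝ} {t : ℝ} (hat : 0 ≤ a t)
    {Φ : Spacetime n → Spacetime n → Prop} {σ : ℝ → Spacetime n}
    (hσ : IsPiecewiseSmoothCurve (Icc 0 1) Φ σ) (ht : ∀ s ∈ Icc (0 : ℝ) 1, (σ s).1 = t) :
    ENNReal.ofReal (a t * ‖(σ 1).2 - (σ 0).2‖) ≤ curveLength a σ := by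
  obtain ⟨S, hS, hd⟩ := hσ.exists_countable_differentiableAt
  have hchord : ‖(σ 1).2 - (σ 0).2‖ₑ
      ≤ ∫⁻ s in Icc (0 : ℝ) 1, ‖deriv (fun s => (σ s).2) s‖ₑ :=
    enorm_sub_le_lintegral_enorm_deriv (f := fun s => (σ s).2) zero_le_one
      (continuous_snd.comp_continuousOn hσ.1) hS fun x hx => (hd x hx).snd
  rw [ENNReal.ofReal_mul hat, ofReal_norm]
  refine (mul_le_mul_right hchord _).trans ?_
  rw [← lintegral_const_mul' _ _ ENNReal.ofReal_ne_top, curveLength,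
    ← restrict_Ioo_eq_restrict_Icc]
  refine lintegral_mono_ae ?_
  filter_upwards [ae_restrict_mem measurableSet_Ioo,
    ae_restrict_of_ae (hS.ae_notMem volume)] with s hs hsS
  have hσs := (hd s ⟨hs, hsS⟩).hasDerivAt
  have hσs' : HasDerivAt (fun s => (σ s).1) (deriv σ s).1 s ∧
      HasDerivAt (fun s => (σ s).2) (deriv σ s).2 s :=
    ⟨(hasFDerivAt_fst (𝕜 := ℝ) (p := σ s)).comp_hasDerivAt s hσs,
      (hasFDerivAt_snd (𝕜 := ℝ) (p := σ s)).comp_hasDerivAt s hσs⟩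
  -- The curve stays in one slice, so the negative term `-dt²` of the metric drops out. This needs
  -- `s` interior, hence the passage to `Ioo`.
  have h1 : (deriv σ s).1 = 0 := by
    have hconst : (fun s => (σ s).1) =ᶠ[𝓝 s] fun _ => t := by
      filter_upwards [Icc_mem_nhds hs.1 hs.2] with y hy using ht y hy
    exact hσs'.1.unique ((hasDerivAt_const s t).congr_of_eventuallyEq hconst)
  rw [hσs'.2.deriv, metric, h1, ht s (Ioo_subset_Icc_self hs), real_inner_self_eq_norm_sq,
    mul_zero, neg_zero, zero_add, ← mul_pow, Real.sqrt_sq (by positivity),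
    ENNReal.ofReal_mul hat, ofReal_norm]

/-- The distance within a subset of a slice dominates the rescaled Euclidean distance. -/
theorem ofReal_mul_norm_sub_le_inducedDist {n : ℕ} {a : ℝ → ℝ} {t : ℝ} (hat : 0 ≤ a t)
    {S : Set (Spacetime n)} (hS : S ⊆ slice n t) (x y : Spacetime n) :
    ENNReal.ofReal (a t * ‖x.2 - y.2‖) ≤ inducedDist a S x y := by
  refine le_iInf₂ ?_
  rintro σ ⟨hσ, rfl, rfl, hmem⟩
  rw [norm_sub_rev]
  exact ofReal_mul_norm_sub_le_curveLength hat hσ fun s hs => (hS (hmem s hs)).2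

/-- If one endpoint is not in `S`, no curve in `S` starts or ends there. -/
theorem inducedDist_eq_top {n : ℕ} {a : ℝ → ℝ} {S : Set (Spacetime n)} {x y : Spacetime n}
    (h : ¬ (x ∈ S ∧ y ∈ S)) : inducedDist a S x y = ⊤ := by
  simp only [inducedDist, iInf_eq_top]
  rintro σ ⟨-, rfl, rfl, hmem⟩
  exact absurd ⟨hmem 0 (left_mem_Icc.2 zero_le_one), hmem 1 (right_mem_Icc.2 zero_le_one)⟩ h

/-- Along points whose coordinate `T` converges within `(-π/2, π/2)` while `exp (-t̂) → ∞`, the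
difference `r - exp (-t̂)` converges. -/
theorem tendsto_exp_neg_sub_of_tendsto_TOf {ι : Type*} {l : Filter ι} {τ r : ι → ℝ} {T : ℝ}
    (hr : ∀ i, 0 ≤ r i) (hτ : Tendsto (fun i => Real.exp (-τ i)) l atTop)
    (hT : Tendsto (fun i => TOf (τ i) (r i)) l (𝓝 T))
    (hmem : T ∈ Ioo (-(Real.pi / 2)) (Real.pi / 2)) :
    Tendsto (fun i => Real.exp (-τ i) - r i) l (𝓝 (Real.tan (-T))) := by
  -- Of the two arctangents in `TOf`, this one saturates at `π / 2`; the limit of `T` then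
  -- determines that of the other.
  have hplus : Tendsto (fun i => Real.arctan (Real.exp (-τ i) + r i)) l (𝓝 (Real.pi / 2)) :=
    (Real.tendsto_arctan_atTop.mono_right nhdsWithin_le_nhds).comp
      (tendsto_atTop_mono (fun i => le_add_of_nonneg_right (hr i)) hτ)
  have hminus : Tendsto (fun i => Real.arctan (Real.exp (-τ i) - r i)) l (𝓝 (-T)) := by
    have h := (hplus.const_sub (Real.pi / 2)).sub hT
    rw [sub_self, zero_sub] at h
    refine h.congr fun i => ?_
    rw [TOf]
    ring
  have hcos : Real.cos (-T) ≠ 0 := by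
    rw [Real.cos_neg]
    exact (Real.cos_pos_of_mem_Ioo hmem).ne'
  refine ((Real.continuousAt_tan.2 hcos).tendsto.comp hminus).congr fun i => ?_
  exact Real.tan_arctan _

/-- Under the same assumption the position is asymptotic to `exp (-t̂)` times its
limiting direction. -/
theorem tendsto_inv_smul_of_tendsto_coord {n : ℕ} {a : ℝ → ℝ} {ι : Type*} {l : Filter ι}
    {p : ι → Spacetime n} {F : ι → ℝ} {T : ℝ} {v : EuclideanSpace ℝ (Fin n)}
    (hF : Tendsto F l atTop) (hpF : ∀ᶠ i in l, Real.exp (-tHat a (p i).1) = F i)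
    (hT : Tendsto (fun i => coordT a (p i)) l (𝓝 T))
    (hmem : T ∈ Ioo (-(Real.pi / 2)) (Real.pi / 2))
    (hv : Tendsto (fun i => coordω (p i)) l (𝓝 v)) :
    Tendsto (fun i => (F i)⁻¹ • (p i).2) l (𝓝 v) := by
  have hdiff : Tendsto (fun i => F i - ‖(p i).2‖) l (𝓝 (Real.tan (-T))) := by
    refine (tendsto_exp_neg_sub_of_tendsto_TOf (fun i => norm_nonneg (p i).2)
      (hF.congr' (hpF.mono fun i hi => hi.symm)) hT hmem).congr' ?_
    filter_upwards [hpF] with i hi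
    rw [hi]
  have hratio : Tendsto (fun i => 1 - (F i)⁻¹ * (F i - ‖(p i).2‖)) l (𝓝 1) := by
    simpa using ((tendsto_inv_atTop_zero.comp hF).mul hdiff).const_sub 1
  have h := hratio.smul hv
  rw [one_smul] at h
  refine h.congr' ?_
  filter_upwards [hF.eventually_gt_atTop 0] with i hi
  have e : 1 - (F i)⁻¹ * (F i - ‖(p i).2‖) = (F i)⁻¹ * ‖(p i).2‖ := by
    field_simp
    ring
  rw [e, coordω, smul_smul]
  -- On the centre line both sides vanish, since `coordω` is `0` there.
  by_cases hx : (p i).2 = 0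
  · simp [hx]
  · rw [mul_assoc, mul_inv_cancel₀ (norm_ne_zero_iff.2 hx), mul_one]

end FLRW

theorem proposition3 (n : ℕ) (hn : 3 ≤ n + 1) (a : ℝ → ℝ)
    (ha_smooth : ContDiff ℝ ∞ a) (ha_pos : ∀ t, 0 < a t)
    (h_i : Tendsto a atBot (𝓝 0))
    (h_ii : Tendsto (fun t : ℝ => ∫ s in t..1, 1 / a s) atBot atTop)
    (h_iii : Tendsto (fun t : ℝ => a t * ∫ s in t..1, 1 / a s) atBot atTop)
    (I₁ I₂ : Set ℝ) (γ₁ γ₂ : ℝ → FLRW.Spacetime n)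
    (hγ₁ : FLRW.IsPastInextendibleTimelikeCurve a (FLRW.M₁ n) I₁ γ₁)
    (hγ₂ : FLRW.IsPastInextendibleTimelikeCurve a (FLRW.M₁ n) I₂ γ₂)
    (T₁ T₂ : ℝ)
    (hT₁ : Tendsto (fun t : ℝ => FLRW.coordT a (γ₁ t)) atBot (𝓝 T₁))
    (hT₂ : Tendsto (fun t : ℝ => FLRW.coordT a (γ₂ t)) atBot (𝓝 T₂))
    (hT₁_mem : T₁ ∈ Ioo (-(Real.pi / 2)) (Real.pi / 2))
    (hT₂_mem : T₂ ∈ Ioo (-(Real.pi / 2)) (Real.pi / 2))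
    (ω₁ ω₂ : Metric.sphere (0 : EuclideanSpace ℝ (Fin n)) 1)
    (hω₁ : Tendsto (fun t : ℝ => FLRW.coordω (γ₁ t)) atBot (𝓝 (ω₁ : EuclideanSpace ℝ (Fin n))))
    (hω₂ : Tendsto (fun t : ℝ => FLRW.coordω (γ₂ t)) atBot (𝓝 (ω₂ : EuclideanSpace ℝ (Fin n))))
    (q : FLRW.Spacetime n) (hq : q ∈ FLRW.M₁ n)
    (hq₁ : ∀ t ∈ I₁, γ₁ t ∉ FLRW.causalPast a (FLRW.M₁ n) q)
    (hq₂ : ∀ t ∈ I₂, γ₂ t ∉ FLRW.causalPast a (FLRW.M₁ n) q)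
    (hω : ω₁ ≠ ω₂) :
    Tendsto (fun t : ℝ =>
        FLRW.inducedDist a (FLRW.slice n t \ FLRW.causalPast a (FLRW.M₁ n) q) (γ₁ t) (γ₂ t))
      atBot (𝓝 ⊤) := by
  set F : ℝ → ℝ := fun t => ∫ s in t..1, 1 / a s with hFdef
  -- Outside `Iᵢ` the value `γᵢ t` is arbitrary, so the asymptotics are taken along times at which
  -- both points have time coordinate `t`. At all other times the distance is `⊤`. The filter `l`
  -- may be trivial, which does no harm.
  set l : Filter ℝ := atBot ⊓ 𝓟 {t | (γ₁ t).1 = t ∧ (γ₂ t).1 = t} with hl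
  have hle : l ≤ atBot := inf_le_left
  have hF : Tendsto F l atTop := h_ii.mono_left hle
  have hmem : ∀ᶠ t in l, (γ₁ t).1 = t ∧ (γ₂ t).1 = t := mem_inf_of_right (mem_principal_self _)
  have hexp : ∀ᶠ t in l, Real.exp (-FLRW.tHat a t) = F t := by
    filter_upwards [hF.eventually_gt_atTop 0] with t ht
    rw [FLRW.tHat, neg_neg, Real.exp_log ht]
  have h1 := FLRW.tendsto_inv_smul_of_tendsto_coord (p := γ₁) hF
    (by filter_upwards [hmem, hexp] with t ht he using by rw [ht.1, he])
    (hT₁.mono_left hle) hT₁_mem (hω₁.mono_left hle)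
  have h2 := FLRW.tendsto_inv_smul_of_tendsto_coord (p := γ₂) hF
    (by filter_upwards [hmem, hexp] with t ht he using by rw [ht.2, he])
    (hT₂.mono_left hle) hT₂_mem (hω₂.mono_left hle)
  have hpos : 0 < ‖(ω₁ : EuclideanSpace ℝ (Fin n)) - ω₂‖ :=
    norm_pos_iff.2 (sub_ne_zero.2 fun h => hω (Subtype.ext h))
  have hprod : Tendsto (fun t => a t * ‖(γ₁ t).2 - (γ₂ t).2‖) l atTop := by
    refine ((h_iii.mono_left hle).atTop_mul_pos hpos (h1.sub h2).norm).congr' ?_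
    filter_upwards [hF.eventually_gt_atTop 0] with t ht
    rw [← smul_sub, norm_smul, norm_inv, Real.norm_of_nonneg ht.le]
    change a t * F t * _ = _
    field_simp
  rw [ENNReal.tendsto_nhds_top_iff_nnreal]
  intro K
  have hK := hprod.eventually_gt_atTop (K : ℝ)
  rw [hl, eventually_inf_principal] at hK
  filter_upwards [hK] with t ht
  by_cases hin : (γ₁ t).1 = t ∧ (γ₂ t).1 = t
  · refine lt_of_lt_of_le ?_
      (FLRW.ofReal_mul_norm_sub_le_inducedDist (ha_pos t).le sdiff_subset _ _)
    rw [← ENNReal.ofReal_coe_nnreal]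
    exact (ENNReal.ofReal_lt_ofReal_iff_of_nonneg K.coe_nonneg).2 (ht hin)
  · rw [FLRW.inducedDist_eq_top fun h => hin ⟨h.1.1.2, h.2.1.2⟩]
    exact ENNReal.coe_lt_top
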